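/- For a prime $p$ and an integer $u$ with $\gcd(u,p)=1$, the Fermat quotient $q_p(u)$ is the unique integer with $$q_p(u)\equiv \frac{u^{p-1}-1}{p} \pmod p,\qquad 0\le q_p(u)\le p-1,$$ and for a positive integer $N$ let $$I_p(N)=\#\{q_p(n)\ :\ 1\le n\le N,\ \gcd(n,p)=1\}.$$ For every real $\varepsilon>0$ there exist $\delta>0$ and $p_0$, both depending only on $\varepsilon$, such that for every prime $p\ge p_0$ and every integer $N$ with $p^{\varepsilon}<N<p$ we have $$I_p(N)\ge p^{\delta}.$$ -/

import Mathlib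

/-- The Fermat quotient `q_p(u)`: the residue in `{0, …, p - 1}` modulo `p` of the number
`(u ^ (p - 1) - 1) / p`, which is an integer when `p` is prime and `gcd(u, p) = 1`. It is only
used for such `p` and `u`. -/
def fermatQuotient (p : ℕ) (u : ℤ) : ℤ :=
  ((u ^ (p - 1) - 1) / (p : ℤ)) % (p : ℤ)

/-- The image size `I_p(N) = #{q_p(n) : 1 ≤ n ≤ N, gcd(n, p) = 1}`. -/
def fermatImageSize (p N : ℕ) : ℕ :=
  (((Finset.Icc 1 N).filter (fun n : ℕ => Nat.gcd n p = 1)).image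
    (fun n : ℕ => fermatQuotient p (n : ℤ))).card

open Finset Filter Topology
open scoped Pointwise

/-! Modulo `p` the Fermat quotient turns products into sums, and together with the residue modulo
`p` it determines an integer prime to `p` modulo `p ^ 2`. Take `k > 2 / ε` and `x = p ^ (2 / k)`, so
that `x < N`. Products of `k` distinct primes up to `x` are below `p ^ 2`, hence separated by at
most `p` residues and at most `I ^ k` sums of quotients, where `I` is the image size. By Chebyshev
there are at least a constant times `p ^ (3 / 2)` such products (`choose_primeCounting_le`), which
forces `I ^ k ≥ p ^ (1 / 4)` for large `p`. -/

/-- Fermat's little theorem modulo `p`, written with the quotient that defines `fermatQuotient`. -/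
lemma pow_pred_eq_one_add_mul_div {p : ℕ} (hp : p.Prime) {u : ℤ} (hu : IsCoprime u p) :
    u ^ (p - 1) = 1 + p * ((u ^ (p - 1) - 1) / p) := by
  have h : (p : ℤ) ∣ u ^ (p - 1) - 1 := (Int.ModEq.pow_card_sub_one_eq_one hp hu).symm.dvd
  rw [Int.mul_ediv_cancel' h]
  ring

lemma fermatQuotient_cast {p : ℕ} (u : ℤ) :
    (fermatQuotient p u : ZMod p) = (((u ^ (p - 1) - 1) / (p : ℤ) : ℤ) : ZMod p) := by
  rw [fermatQuotient, ZMod.intCast_eq_intCast_iff]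
  exact Int.mod_modEq _ _

/-- Because `(1 + p a) (1 + p b) = 1 + p (a + b + p a b)`. -/
lemma fermatQuotient_cast_mul {p : ℕ} (hp : p.Prime) {u v : ℤ} (hu : IsCoprime u p)
    (hv : IsCoprime v p) :
    (fermatQuotient p (u * v) : ZMod p) = fermatQuotient p u + fermatQuotient p v := by
  have h₁ := pow_pred_eq_one_add_mul_div hp hu
  have h₂ := pow_pred_eq_one_add_mul_div hp hv
  have h₃ := pow_pred_eq_one_add_mul_div hp (hu.mul_left hv)
  simp only [fermatQuotient_cast]
  set a := (u ^ (p - 1) - 1) / (p : ℤ)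
  set b := (v ^ (p - 1) - 1) / (p : ℤ)
  set c := ((u * v) ^ (p - 1) - 1) / (p : ℤ)
  rw [mul_pow, h₁, h₂] at h₃
  have hp0 : (p : ℤ) ≠ 0 := by exact_mod_cast hp.ne_zero
  have hc : c = a + b + p * (a * b) := mul_left_cancel₀ hp0 (by linear_combination -h₃)
  simp [hc]

lemma fermatQuotient_cast_one (p : ℕ) : (fermatQuotient p 1 : ZMod p) = 0 := by
  simp [fermatQuotient]

lemma fermatQuotient_cast_prod {p : ℕ} (hp : p.Prime) {ι : Type*} (s : Finset ι) (f : ι → ℤ)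
    (hf : ∀ i ∈ s, IsCoprime (f i) p) :
    (fermatQuotient p (∏ i ∈ s, f i) : ZMod p) = ∑ i ∈ s, (fermatQuotient p (f i) : ZMod p) := by
  classical
  induction s using Finset.induction_on with
  | empty => simp [fermatQuotient_cast_one]
  | insert a s ha ih =>
    have hs : ∀ i ∈ s, IsCoprime (f i) p := fun i hi => hf i (mem_insert_of_mem hi)
    rw [prod_insert ha, sum_insert ha, fermatQuotient_cast_mul hp (hf a (mem_insert_self a s))
      (IsCoprime.prod_left hs), ih hs]

/-- An integer coprime to `p` is determined modulo `p ^ 2` by its residue modulo `p` together with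
its Fermat quotient. -/
lemma modEq_sq_of_fermatQuotient_eq {p : ℕ} (hp : p.Prime) {u v : ℤ} (hu : IsCoprime u p)
    (hv : IsCoprime v p) (huv : u ≡ v [ZMOD p])
    (hq : (fermatQuotient p u : ZMod p) = fermatQuotient p v) :
    u ≡ v [ZMOD (p : ℤ) ^ 2] := by
  have h₁ := pow_pred_eq_one_add_mul_div hp hu
  have h₂ := pow_pred_eq_one_add_mul_div hp hv
  rw [fermatQuotient_cast, fermatQuotient_cast, ZMod.intCast_eq_intCast_iff] at hq
  obtain ⟨t, ht⟩ := hq.dvd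
  -- Raising to the power `p` lifts a congruence modulo `p` to one modulo `p ^ 2`; equal quotients
  -- give `u ^ (p - 1) ≡ v ^ (p - 1)` there too, and cancelling this unit leaves `u ≡ v`.
  have hpow : (p : ℤ) ^ 2 ∣ v ^ p - u ^ p := by
    simpa using dvd_sub_pow_of_dvd_sub huv.dvd 1
  have hpred : p = (p - 1) + 1 := (Nat.sub_add_cancel hp.one_le).symm
  have hmul : (p : ℤ) ^ 2 ∣ u ^ (p - 1) * (v - u) := by
    have h : u ^ (p - 1) * (v - u) = (v ^ p - u ^ p) - (v ^ (p - 1) - u ^ (p - 1)) * v := by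
      have hv' : v ^ p = v ^ (p - 1) * v := by conv_lhs => rw [hpred, pow_succ]
      have hu' : u ^ p = u ^ (p - 1) * u := by conv_lhs => rw [hpred, pow_succ]
      rw [hv', hu']
      ring
    rw [h]
    refine dvd_sub hpow (Dvd.dvd.mul_right ⟨t, ?_⟩ v)
    rw [h₁, h₂]
    linear_combination (p : ℤ) * ht
  exact Int.modEq_iff_dvd.2 ((hu.pow (m := p - 1) (n := 2)).symm.dvd_of_dvd_mul_left hmul)

lemma fermatImageSize_mono (p : ℕ) : Monotone (fermatImageSize p) := fun _ _ h =>
  card_le_card (image_subset_image (filter_subset_filter _ (Icc_subset_Icc_right h)))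

/-- The products of `k` distinct primes up to `N` are told apart by their residue modulo `p` and
their Fermat quotient, and the latter lies in a `k`-fold sumset of the Fermat quotients up to
`N`. -/
lemma choose_primeCounting_le {p : ℕ} (hp : p.Prime) {N k : ℕ} (hN : N < p) (hk : N ^ k ≤ p ^ 2) :
    (Nat.primeCounting N).choose k ≤ fermatImageSize p N ^ k * p := by
  classical
  have : Fact p.Prime := ⟨hp⟩
  set A : Finset (ZMod p) := (((Icc 1 N).filter (fun n : ℕ => Nat.gcd n p = 1)).image
    (fun n : ℕ => fermatQuotient p (n : ℤ))).image (fun a : ℤ => (a : ZMod p)) with hA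
  have hAcard : #A ≤ fermatImageSize p N := card_image_le
  have hcop : ∀ r ∈ Nat.primesLE N, Nat.Coprime r p := fun r hr =>
    (Nat.coprime_primes (Nat.prime_of_mem_primesLE hr) hp).2
      ((Nat.le_of_mem_primesLE hr).trans_lt hN).ne
  have hmemA : ∀ r ∈ Nat.primesLE N, (fermatQuotient p (r : ℤ) : ZMod p) ∈ A := fun r hr =>
    mem_image_of_mem _ (mem_image_of_mem _ (mem_filter.2 ⟨mem_Icc.2
      ⟨(Nat.prime_of_mem_primesLE hr).one_le, Nat.le_of_mem_primesLE hr⟩, hcop r hr⟩))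
  have hprodcop : ∀ S ⊆ Nat.primesLE N, Nat.Coprime (∏ r ∈ S, r) p := fun S hS =>
    Nat.Coprime.prod_left fun r hr => hcop r (hS hr)
  have hlt : ∀ S ∈ (Nat.primesLE N).powersetCard k, ∏ r ∈ S, r < p ^ 2 := by
    intro S hS
    obtain ⟨hS, hcard⟩ := mem_powersetCard.1 hS
    refine lt_of_le_of_ne ?_ fun h => ?_
    · refine le_trans ?_ hk
      rw [← hcard]
      exact prod_le_pow_card _ _ _ fun r hr => Nat.le_of_mem_primesLE (hS hr)
    -- Equality would contradict coprimality to `p`; strictness makes the residue modulo `p ^ 2`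
    -- determine the product.
    · have h' := hprodcop S hS
      rw [h, Nat.coprime_pow_left_iff two_pos, Nat.coprime_self] at h'
      exact hp.one_lt.ne' h'
  have hqprod : ∀ S ⊆ Nat.primesLE N, (fermatQuotient p ((∏ r ∈ S, r : ℕ) : ℤ) : ZMod p)
      = ∑ r ∈ S, (fermatQuotient p (r : ℤ) : ZMod p) := fun S hS => by
    rw [Nat.cast_prod]
    exact fermatQuotient_cast_prod hp _ _ fun r hr => Nat.isCoprime_iff_coprime.2 (hcop r (hS hr))
  have hcard : #((Nat.primesLE N).powersetCard k) ≤ #((k • A) ×ˢ (univ : Finset (ZMod p))) := by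
    refine card_le_card_of_injOn
      (fun S => (∑ r ∈ S, (fermatQuotient p (r : ℤ) : ZMod p), ((∏ r ∈ S, r : ℕ) : ZMod p))) ?_ ?_
    · intro S hS
      obtain ⟨hS, hcard⟩ := mem_powersetCard.1 hS
      refine mem_product.2 ⟨?_, mem_univ _⟩
      rw [← mem_coe, coe_nsmul, ← hcard, ← sum_const]
      exact Set.finsetSum_mem_finsetSum S _ _ fun r hr => hmemA r (hS hr)
    · intro S hS T hT h
      have hS' := (mem_powersetCard.1 hS).1
      have hT' := (mem_powersetCard.1 hT).1
      obtain ⟨hq, hmod⟩ := Prod.mk.inj h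
      rw [← hqprod S hS', ← hqprod T hT'] at hq
      rw [ZMod.natCast_eq_natCast_iff] at hmod
      have hsq := modEq_sq_of_fermatQuotient_eq hp (Nat.isCoprime_iff_coprime.2 (hprodcop S hS'))
        (Nat.isCoprime_iff_coprime.2 (hprodcop T hT')) (Int.natCast_modEq_iff.2 hmod) hq
      have heq : ∏ r ∈ S, r = ∏ r ∈ T, r := Nat.ModEq.eq_of_lt_of_lt
        (Int.natCast_modEq_iff.1 (by exact_mod_cast hsq)) (hlt S hS) (hlt T hT)
      rw [← Nat.primeFactors_prod fun r hr => Nat.prime_of_mem_primesLE (hS' hr), heq,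
        Nat.primeFactors_prod fun r hr => Nat.prime_of_mem_primesLE (hT' hr)]
  rw [card_powersetCard, Nat.primesLE_card_eq_primeCounting, card_product, card_univ,
    ZMod.card] at hcard
  exact hcard.trans (Nat.mul_le_mul_right _
    (card_nsmul_le.trans (Nat.pow_le_pow_left hAcard k)))

/-- A weak form of Chebyshev's bound. Any exponent in `(1 / 2, 1)` would serve: with `x ^ k = p ^
2`, the count must beat the `p` residues. -/
lemma eventually_rpow_le_primeCounting :
    ∀ᶠ x : ℝ in atTop, x ^ (3 / 4 : ℝ) ≤ Nat.primeCounting ⌊x⌋₊ := by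
  have hlog := (isLittleO_log_rpow_atTop (r := 1 / 4) (by norm_num)).bound
    (show (0 : ℝ) < 1 / 8 by norm_num)
  filter_upwards [hlog, eventually_ge_atTop 16] with x hx h16
  have hx0 : 0 < x := by linarith
  have hlogpos : 0 < Real.log x := Real.log_pos (by linarith)
  rw [Real.norm_of_nonneg hlogpos.le, Real.norm_of_nonneg (by positivity)] at hx
  have hsplit : x ^ (3 / 4 : ℝ) * x ^ (1 / 4 : ℝ) = x := by
    rw [← Real.rpow_add hx0]
    norm_num
  have hquarter : x ^ (1 / 4 : ℝ) ≤ x := by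
    conv_rhs => rw [← Real.rpow_one x]
    exact Real.rpow_le_rpow_of_exponent_le (by linarith) (by norm_num)
  have hlog2 : Real.log (x + 2) ≤ 2 * Real.log x := by
    rw [← Real.log_rpow hx0, Real.rpow_two]
    exact Real.log_le_log (by linarith) (by nlinarith)
  refine le_trans ?_ (Chebyshev.pi_ge' (by linarith))
  rw [le_div_iff₀ hlogpos]
  have hmul : x ^ (3 / 4 : ℝ) * Real.log x ≤ x / 8 := by
    calc x ^ (3 / 4 : ℝ) * Real.log x ≤ x ^ (3 / 4 : ℝ) * (1 / 8 * x ^ (1 / 4 : ℝ)) := by gcongr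
      _ = x / 8 := by linear_combination (1 / 8) * hsplit
  nlinarith [Real.log_two_gt_d9]

theorem theorem12 (ε : ℝ) (hε : 0 < ε) :
    ∃ δ : ℝ, 0 < δ ∧ ∃ p₀ : ℕ, ∀ p : ℕ, p.Prime → p₀ ≤ p →
      ∀ N : ℕ, (p : ℝ) ^ ε < (N : ℝ) → N < p →
        (p : ℝ) ^ δ ≤ (fermatImageSize p N : ℝ) := by
  obtain ⟨k, hk⟩ := exists_nat_gt (2 / ε)
  have hk0 : (0 : ℝ) < k := lt_trans (by positivity) hk
  have hkε : 2 / (k : ℝ) ≤ ε := by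
    rw [div_lt_iff₀ hε] at hk
    rw [div_le_iff₀ hk0]
    linarith
  have htend : Tendsto (fun p : ℕ => (p : ℝ) ^ (2 / k : ℝ)) atTop atTop :=
    (tendsto_rpow_atTop (by positivity)).comp tendsto_natCast_atTop_atTop
  have htend' : Tendsto (fun p : ℕ => ((p : ℝ) ^ (2 / k : ℝ)) ^ (3 / 4 : ℝ)) atTop atTop :=
    (tendsto_rpow_atTop (by norm_num)).comp htend
  have hconst : Tendsto (fun p : ℕ => (p : ℝ) ^ (1 / 4 : ℝ)) atTop atTop :=
    (tendsto_rpow_atTop (by norm_num)).comp tendsto_natCast_atTop_atTop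
  obtain ⟨p₀, hp₀⟩ := eventually_atTop.1 ((htend.eventually eventually_rpow_le_primeCounting).and
    ((htend'.eventually_ge_atTop (2 * k : ℝ)).and
      (hconst.eventually_ge_atTop ((2 : ℝ) ^ k * k.factorial))))
  refine ⟨1 / (4 * k), by positivity, p₀, fun p hp hpp N hpN hNp => ?_⟩
  obtain ⟨hπ, hxk, hpc⟩ := hp₀ p hpp
  set x : ℝ := (p : ℝ) ^ (2 / k : ℝ) with hx
  have hp1 : (1 : ℝ) ≤ p := by exact_mod_cast hp.one_le
  have hp0 : (0 : ℝ) < p := by linarith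
  have hx0 : 0 < x := by positivity
  have hxpow : x ^ k = (p : ℝ) ^ 2 := by
    rw [hx, ← Real.rpow_mul_natCast hp0.le, div_mul_cancel₀ _ hk0.ne', Real.rpow_two]
  -- `N ^ k` may exceed `p ^ 2`, so the count is made at `⌊x⌋₊` and carried to `N` by monotonicity.
  have hfloor : ⌊x⌋₊ ≤ N := Nat.floor_le_of_le
    ((Real.rpow_le_rpow_of_exponent_le hp1 hkε).trans hpN.le)
  have hfloorpow : ⌊x⌋₊ ^ k ≤ p ^ 2 := by
    have h : (⌊x⌋₊ : ℝ) ^ k ≤ (p : ℝ) ^ 2 := by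
      rw [← hxpow]
      gcongr
      exact Nat.floor_le hx0.le
    exact_mod_cast h
  have hcount : (((Nat.primeCounting ⌊x⌋₊).choose k : ℕ) : ℝ)
      ≤ (fermatImageSize p N : ℝ) ^ k * p := by
    exact_mod_cast (choose_primeCounting_le hp (hfloor.trans_lt hNp) hfloorpow).trans
      (Nat.mul_le_mul_right _ (Nat.pow_le_pow_left (fermatImageSize_mono p hfloor) k))
  set n := Nat.primeCounting ⌊x⌋₊
  have hkn : k ≤ n := by
    have h : (k : ℝ) ≤ n := by linarith
    exact_mod_cast h
  have hhalf : x ^ (3 / 4 : ℝ) / 2 ≤ ((n + 1 - k : ℕ) : ℝ) := by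
    rw [Nat.cast_sub (by lia)]
    push_cast
    linarith
  have hfac : (0 : ℝ) < k.factorial := by exact_mod_cast k.factorial_pos
  have hlower : (x ^ (3 / 4 : ℝ) / 2) ^ k ≤ k.factorial * (n.choose k : ℝ) := by
    refine (pow_le_pow_left₀ (by positivity) hhalf k).trans ?_
    have h := Nat.pow_le_choose (α := ℝ) k n
    rw [div_le_iff₀ hfac] at h
    linarith
  -- The power `p ^ (3 / 2)` is split three ways: `p` pays for the residues, one `p ^ (1 / 4)`
  -- absorbs `2 ^ k * k!`, and the other is the gain.
  have hxp : (x ^ (3 / 4 : ℝ)) ^ k = (p : ℝ) ^ (1 / 4 : ℝ) * (p : ℝ) ^ (1 / 4 : ℝ) * p := by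
    rw [← Real.rpow_mul_natCast hx0.le, mul_comm, Real.rpow_natCast_mul hx0.le, hxpow,
      ← Real.rpow_natCast_mul hp0.le, ← Real.rpow_add hp0]
    nth_rewrite 3 [← Real.rpow_one (p : ℝ)]
    rw [← Real.rpow_add hp0]
    norm_num
  have hpow : (p : ℝ) ^ (1 / 4 : ℝ) ≤ (fermatImageSize p N : ℝ) ^ k := by
    set y := (p : ℝ) ^ (1 / 4 : ℝ)
    set M := (fermatImageSize p N : ℝ)
    have hy : 0 < y := by positivity
    rw [div_pow, hxp, div_le_iff₀ (by positivity)] at hlower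
    have h : y * y * p ≤ y * M ^ k * p := by
      calc y * y * p ≤ k.factorial * (n.choose k : ℝ) * 2 ^ k := hlower
        _ ≤ k.factorial * (M ^ k * p) * 2 ^ k := by gcongr
        _ = (2 ^ k * k.factorial) * (M ^ k * p) := by ring
        _ ≤ y * (M ^ k * p) := by gcongr
        _ = y * M ^ k * p := by ring
    exact le_of_mul_le_mul_left (le_of_mul_le_mul_right h hp0) hy
  refine le_of_pow_le_pow_left₀ (n := k) (by exact_mod_cast hk0.ne') (by positivity) ?_
  rwa [← Real.rpow_mul_natCast hp0.le, show 1 / (4 * (k : ℝ)) * k = 1 / 4 by field_simp]
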